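/- For a finite word $x$ let $x^R$ denote its reversal. A factor of a word is a contiguous subword. Let $\mathcal{N}$ be the set of words over the alphabet $\{0,1\}$ that have no factor of the form $xxx^R$ with $x$ a non-empty word. Then there is a real constant $c$ such that the number of words of length $n$ in $\mathcal{N}$ is $O(n^{\lg n + c})$ as $n \to \infty$, where $\lg$ denotes the base-$2$ logarithm. -/

import Mathlib

/-- A binary word (a list over the two-letter alphabet `Bool`, with `false` for the letter `0` and
`true` for the letter `1`) avoids `x x x^R` if it has no factor (contiguous subword) of the form
`x x x^R` with `x` non-empty, where `x^R` is the reversal of `x`. -/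
def AvoidsXXXR (z : List Bool) : Prop :=
  ∀ x : List Bool, x ≠ [] → ¬ (x ++ x ++ x.reverse <:+: z)

/-- The set of binary words of length `n` that avoid `x x x^R`. -/
def avoidingWords (n : ℕ) : Set (List Bool) :=
  {z | z.length = n ∧ AvoidsXXXR z}

/-- There are finitely many such words, so their number is faithfully given by `Set.ncard`. -/
theorem avoidingWords_finite (n : ℕ) : (avoidingWords n).Finite :=
  (List.finite_length_eq Bool n).subset fun _ hz => hz.1

/-- The number of binary words of length `n` that avoid `x x x^R`. -/
noncomputable def numAvoidingWords (n : ℕ) : ℕ :=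
  (avoidingWords n).ncard

/-! Write 0, 1 for `false`, `true` and S for `blockSubst`. Avoiding xxx^R excludes 000 and 111, so a
word is given by its first letter and its run lengths, themselves a binary word. In this coding the
pattern xxx^R becomes a family of patterns whose palindromic centre is the letter 1
(`AvoidsXXXR.avoidsCenterTrue`).

If S(w) avoids that family, w avoids one with centre 0; one more step gives empty centre, and a
third gives centre 1 again (the `desubst` lemmas). The reason is that S maps centre 0 to 1, centre 1
to empty, and an empty centre to 0.

The smallest patterns of each family force every word into the form u p S(w') q v, with u, v of
bounded length and only linearly many choices for each of p, q
(`AvoidsSomeCenter.exists_eq_append_blockSubst`). As S at least doubles lengths, the number F(n) of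
words of length at most n satisfies F(n) ≤ C(n+1)²F(n/2), which solves to n^(lg n + c). -/

/-- The substitution `false ↦ false true`, `true ↦ false true true`. -/
def blockSubst : List Bool → List Bool
  | [] => []
  | false :: w => false :: true :: blockSubst w
  | true :: w => false :: true :: true :: blockSubst w

theorem blockSubst_append (u v : List Bool) :
    blockSubst (u ++ v) = blockSubst u ++ blockSubst v := by
  induction u with
  | nil => rfl
  | cons c u ih => cases c <;> simp [blockSubst, ih]

/-- The blocks 01 and 011 become palindromes once a 0 is appended, so S commutes with reversal up to
moving one 0 across. -/
theorem blockSubst_reverse_append (w l : List Bool) :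
    blockSubst w.reverse ++ false :: l = false :: ((blockSubst w).reverse ++ l) := by
  induction w generalizing l with
  | nil => rfl
  | cons c w ih => cases c <;> simp [blockSubst, blockSubst_append, ih]

theorem two_mul_length_le_length_blockSubst (w : List Bool) :
    2 * w.length ≤ (blockSubst w).length := by
  induction w with
  | nil => simp
  | cons c w ih => cases c <;> simp [blockSubst] <;> omega

theorem length_blockSubst (w : List Bool) :
    (blockSubst w).length = 2 * w.count false + 3 * w.count true := by
  induction w with
  | nil => simp [blockSubst]
  | cons c w ih => cases c <;> simp [blockSubst, ih] <;> omega

theorem count_true_blockSubst (w : List Bool) :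
    (blockSubst w).count true = w.count false + 2 * w.count true := by
  induction w with
  | nil => simp [blockSubst]
  | cons c w ih => cases c <;> simp [blockSubst, ih] <;> omega

theorem count_false_blockSubst (w : List Bool) :
    (blockSubst w).count false = w.length := by
  induction w with
  | nil => simp [blockSubst]
  | cons c w ih => cases c <;> simp [blockSubst, ih]

theorem exists_blockSubst_eq_append_true (u : List Bool) (hu : 2 ≤ u.length) :
    ∃ u', blockSubst u = u' ++ [true] ∧ 2 ≤ u'.length := by
  obtain ⟨v, c, rfl⟩ : ∃ v c, u = v ++ [c] :=
    (List.eq_nil_or_concat' u).resolve_left (by rintro rfl; simp at hu)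
  have hv := two_mul_length_le_length_blockSubst v
  simp only [List.length_append, List.length_cons, List.length_nil] at hu
  cases c
  · exact ⟨blockSubst v ++ [false], by simp [blockSubst_append, blockSubst], by simp; omega⟩
  · exact ⟨blockSubst v ++ [false, true], by simp [blockSubst_append, blockSubst], by simp⟩

theorem exists_blockSubst_eq_cons (v : List Bool) (hv : 2 ≤ v.length) :
    ∃ v', blockSubst v = false :: true :: v' ∧ 2 ≤ v'.length := by
  match v, hv with
  | c :: d :: v, _ =>
    cases c <;> cases d <;> exact ⟨_, rfl, by simp [blockSubst]⟩

/-! ### Pattern families and their desubstitution -/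

/-- `p` occurs in `w` with at least two letters to its left and two to its right. -/
def OccursInside (p w : List Bool) : Prop :=
  ∃ u v, 2 ≤ u.length ∧ 2 ≤ v.length ∧ w = u ++ p ++ v

theorem OccursInside.of_infix {p w w' : List Bool} (h : OccursInside p w) (hw : w <:+: w') :
    OccursInside p w' := by
  obtain ⟨u, v, hu, hv, rfl⟩ := h
  obtain ⟨a, b, rfl⟩ := hw
  exact ⟨a ++ u, v ++ b, by simp; omega, by simp; omega, by simp⟩

/-- The patterns with palindromic centre `true` do not occur inside `w`. -/
structure AvoidsCenterTrue (w : List Bool) : Prop where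
  square : ∀ q : List Bool, Odd q.length →
    ¬ OccursInside (q ++ true :: q ++ true :: q.reverse) w
  long_border : ∀ q : List Bool, Even q.length →
    ¬ OccursInside (true :: q ++ false :: true :: q ++ true :: q.reverse ++ [true]) w
  short_border : ∀ q : List Bool, Even q.length →
    ¬ OccursInside (q ++ false :: false :: q ++ true :: q.reverse) w

/-- The patterns with palindromic centre `false` do not occur inside `w`. -/
structure AvoidsCenterFalse (w : List Bool) : Prop where
  square : ∀ y : List Bool, Even (y.count true) →
    ¬ OccursInside (y ++ false :: y ++ false :: y.reverse) w
  mixed : ∀ y : List Bool, Odd (y.count true) →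
    ¬ OccursInside (y ++ true :: y ++ false :: y.reverse) w

/-- The patterns with empty palindromic centre do not occur inside `w`. -/
structure AvoidsCenterEmpty (w : List Bool) : Prop where
  long_border : ∀ z : List Bool, Even (z.count false) →
    ¬ OccursInside (true :: z ++ true :: z ++ z.reverse ++ [true]) w
  short_border : ∀ z : List Bool, Odd (z.count false) →
    ¬ OccursInside (z ++ false :: z ++ z.reverse) w
  true_false_false : ¬ OccursInside [true, false, false] w

/-- The image of a forbidden pattern, completed by the 1 that ends the preceding block or the 0 that
starts the next, is again forbidden. Two letters of margin pay for this: their image has at least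
four letters, so two remain after the loan. The parity conditions match through the letter counts of
S. -/
theorem AvoidsCenterTrue.desubst {w : List Bool} (h : AvoidsCenterTrue (blockSubst w)) :
    AvoidsCenterFalse w := by
  constructor
  · rintro y hy ⟨u, v, hu, hv, rfl⟩
    obtain ⟨v', hv', hv2⟩ := exists_blockSubst_eq_cons v hv
    refine h.square (blockSubst y ++ [false]) ?_
      ⟨blockSubst u, true :: v', ?_, by simp; omega, ?_⟩
    · rw [List.length_append, length_blockSubst]
      simp only [List.length_cons, List.length_nil]
      grind
    · have := two_mul_length_le_length_blockSubst u; omega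
    · simp [blockSubst_append, blockSubst, hv', blockSubst_reverse_append]
  · rintro y hy ⟨u, v, hu, hv, rfl⟩
    obtain ⟨u', hu', hu2⟩ := exists_blockSubst_eq_append_true u hu
    obtain ⟨v', hv', hv2⟩ := exists_blockSubst_eq_cons v hv
    refine h.square (true :: blockSubst y ++ [false]) ?_ ⟨u', v', hu2, hv2, ?_⟩
    · rw [List.length_append, List.length_cons, length_blockSubst]
      simp only [List.length_cons, List.length_nil]
      grind
    · simp [blockSubst_append, blockSubst, hv', hu', blockSubst_reverse_append]

theorem AvoidsCenterFalse.desubst {w : List Bool} (h : AvoidsCenterFalse (blockSubst w)) :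
    AvoidsCenterEmpty w := by
  constructor
  · rintro z hz ⟨u, v, hu, hv, rfl⟩
    refine h.square (true :: true :: blockSubst z) ?_
      ⟨blockSubst u ++ [false], blockSubst v, ?_, ?_, ?_⟩
    · simp only [List.count_cons_self, count_true_blockSubst]
      grind
    · have := two_mul_length_le_length_blockSubst u; simp; omega
    · have := two_mul_length_le_length_blockSubst v; omega
    · simp [blockSubst_append, blockSubst, blockSubst_reverse_append]
  · rintro z hz ⟨u, v, hu, hv, rfl⟩
    obtain ⟨u', hu', hu2⟩ := exists_blockSubst_eq_append_true u hu
    obtain ⟨v', hv', hv2⟩ := exists_blockSubst_eq_cons v hv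
    refine h.square (true :: blockSubst z) ?_ ⟨u', v', hu2, hv2, ?_⟩
    · simp only [List.count_cons_self, count_true_blockSubst]
      grind
    · simp [blockSubst_append, blockSubst, hv', hu', blockSubst_reverse_append]
  · rintro ⟨u, v, hu, hv, rfl⟩
    obtain ⟨v', hv', hv2⟩ := exists_blockSubst_eq_cons v hv
    -- S(100) followed by 0 is 01·1·01·0·10.
    refine h.mixed [false, true] (by simp) ⟨blockSubst u, true :: v', ?_, by simp; omega, ?_⟩
    · have := two_mul_length_le_length_blockSubst u; omega
    · simp [blockSubst_append, blockSubst, hv']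

theorem AvoidsCenterEmpty.desubst {w : List Bool} (h : AvoidsCenterEmpty (blockSubst w)) :
    AvoidsCenterTrue w := by
  constructor
  · rintro q hq ⟨u, v, hu, hv, rfl⟩
    obtain ⟨u', hu', hu2⟩ := exists_blockSubst_eq_append_true u hu
    obtain ⟨v', hv', hv2⟩ := exists_blockSubst_eq_cons v hv
    refine h.long_border (blockSubst q ++ [false, true]) ?_ ⟨u', v', hu2, hv2, ?_⟩
    · rw [List.count_append, count_false_blockSubst]
      simp
      grind
    · simp [blockSubst_append, blockSubst, hv', hu', blockSubst_reverse_append]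
  · rintro q hq ⟨u, v, hu, hv, rfl⟩
    refine h.short_border (true :: true :: blockSubst q ++ [false, true]) ?_
      ⟨blockSubst u ++ [false], blockSubst v, ?_, ?_, ?_⟩
    · rw [List.count_append]
      simp [count_false_blockSubst]
      grind
    · have := two_mul_length_le_length_blockSubst u; simp; omega
    · have := two_mul_length_le_length_blockSubst v; omega
    · simp [blockSubst_append, blockSubst, blockSubst_reverse_append]
  · rintro q hq ⟨u, v, hu, hv, rfl⟩
    obtain ⟨u', hu', hu2⟩ := exists_blockSubst_eq_append_true u hu
    obtain ⟨v', hv', hv2⟩ := exists_blockSubst_eq_cons v hv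
    refine h.short_border (true :: blockSubst q ++ [false, true]) ?_ ⟨u', v', hu2, hv2, ?_⟩
    · rw [List.count_append]
      simp [count_false_blockSubst]
      grind
    · simp [blockSubst_append, blockSubst, hv', hu', blockSubst_reverse_append]

/-! ### Run-length coding -/

/-- The word over `{0, 1}` with first letter `c` whose run lengths are listed by `r`, where `false`
stands for a run of length one and `true` for a run of length two. -/
def runDecode : Bool → List Bool → List Bool
  | _, [] => []
  | c, false :: r => c :: runDecode (!c) r
  | c, true :: r => c :: c :: runDecode (!c) r

theorem runDecode_append (c : Bool) (a b : List Bool) :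
    runDecode c (a ++ b) = runDecode c a ++ runDecode (c ^^ decide (Odd a.length)) b := by
  induction a generalizing c with
  | nil => simp [runDecode]
  | cons d a ih =>
    have : ((!c) ^^ decide (Odd a.length)) = (c ^^ decide (Odd (a.length + 1))) := by
      rcases Nat.even_or_odd a.length with h | h
      · simp [Nat.not_odd_iff_even.2 h, h.add_one]
      · simp [h, Nat.not_odd_iff_even.2 h.add_one]
    cases d <;> simp [runDecode, ih, this]

theorem runDecode_append_even (c : Bool) {a : List Bool} (ha : Even a.length) (b : List Bool) :
    runDecode c (a ++ b) = runDecode c a ++ runDecode c b := by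
  simp [runDecode_append, Nat.not_odd_iff_even.2 ha]

theorem runDecode_append_odd (c : Bool) {a : List Bool} (ha : Odd a.length) (b : List Bool) :
    runDecode c (a ++ b) = runDecode c a ++ runDecode (!c) b := by
  simp [runDecode_append, ha]

theorem reverse_runDecode (c : Bool) (r : List Bool) :
    (runDecode c r).reverse = runDecode (c ^^ decide (Even r.length)) r.reverse := by
  induction r generalizing c with
  | nil => simp [runDecode]
  | cons d r ih =>
    rcases Nat.even_or_odd r.length with h | h
    · cases d <;>
        simp [runDecode, ih, runDecode_append, h, Nat.not_odd_iff_even.2 h,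
          Nat.not_even_iff_odd.2 h.add_one]
    · cases d <;>
        simp [runDecode, ih, runDecode_append, h, Nat.not_even_iff_odd.2 h, h.add_one]

theorem reverse_runDecode_even (c : Bool) {r : List Bool} (h : Even r.length) :
    (runDecode c r).reverse = runDecode (!c) r.reverse := by
  simp [reverse_runDecode, h]

theorem reverse_runDecode_odd (c : Bool) {r : List Bool} (h : Odd r.length) :
    (runDecode c r).reverse = runDecode c r.reverse := by
  simp [reverse_runDecode, Nat.not_even_iff_odd.2 h]

theorem length_le_length_runDecode (c : Bool) (r : List Bool) :
    r.length ≤ (runDecode c r).length := by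
  induction r generalizing c with
  | nil => simp
  | cons d r ih =>
    have := ih (!c)
    cases d <;> simp [runDecode] <;> omega

theorem exists_runDecode_eq_append (c : Bool) (u : List Bool) (hu : u ≠ []) :
    ∃ d a, ∀ r, runDecode c (u ++ r) = a ++ d :: runDecode (!d) r := by
  induction u generalizing c with
  | nil => exact absurd rfl hu
  | cons e u ih =>
    rcases eq_or_ne u [] with rfl | hu'
    · cases e
      · exact ⟨c, [], fun r => by simp [runDecode]⟩
      · exact ⟨c, [c], fun r => by simp [runDecode]⟩
    · obtain ⟨d, a, h⟩ := ih (!c) hu'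
      cases e
      · exact ⟨d, c :: a, fun r => by simp [runDecode, h]⟩
      · exact ⟨d, c :: c :: a, fun r => by simp [runDecode, h]⟩

theorem exists_runDecode_eq_cons (c : Bool) (v : List Bool) (hv : v ≠ []) :
    ∃ b, runDecode c v = c :: b := by
  match v, hv with
  | false :: v, _ => exact ⟨_, rfl⟩
  | true :: v, _ => exact ⟨_, rfl⟩

/-- The last letter of x and the first of x^R fuse into a double run, the centre 1. The three cases
are: x begins and ends with the same letter, x begins with a double run and ends differently, x
begins with a single letter and ends differently. Parity of |q| fixes which letter follows q. In the
first and third cases the outer letters of xxx^R come from the neighbouring runs. -/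
theorem AvoidsXXXR.avoidsCenterTrue {c : Bool} {r : List Bool} (h : AvoidsXXXR (runDecode c r)) :
    AvoidsCenterTrue r := by
  constructor
  · rintro q hq ⟨u, v, hu, hv, rfl⟩
    obtain ⟨d, a, ha⟩ := exists_runDecode_eq_append c u (by rintro rfl; simp at hu)
    obtain ⟨b, hb⟩ := exists_runDecode_eq_cons d v (by rintro rfl; simp at hv)
    have hq' : Odd q.reverse.length := by simpa using hq
    refine h (d :: runDecode (!d) q ++ [d]) (by simp) ⟨a, b, ?_⟩
    simp [ha, runDecode_append_odd _ hq, runDecode_append_odd _ hq', runDecode, hb,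
      reverse_runDecode_odd _ hq]
  · rintro q hq ⟨u, v, hu, hv, rfl⟩
    obtain ⟨d, a, ha⟩ := exists_runDecode_eq_append c u (by rintro rfl; simp at hu)
    have hq' : Even q.reverse.length := by simpa using hq
    refine h ((!d) :: (!d) :: runDecode d q ++ [d]) (by simp) ⟨a ++ [d], runDecode d v, ?_⟩
    simp [ha, runDecode_append_even _ hq, runDecode_append_even _ hq', runDecode,
      reverse_runDecode_even _ hq]
  · rintro q hq ⟨u, v, hu, hv, rfl⟩
    obtain ⟨d, a, ha⟩ := exists_runDecode_eq_append c u (by rintro rfl; simp at hu)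
    obtain ⟨b, hb⟩ := exists_runDecode_eq_cons d v (by rintro rfl; simp at hv)
    have hq' : Even q.reverse.length := by simpa using hq
    refine h (d :: runDecode (!d) q ++ [!d]) (by simp) ⟨a, b, ?_⟩
    simp [ha, runDecode_append_even _ hq, runDecode_append_even _ hq', runDecode, hb,
      reverse_runDecode_even _ hq]

theorem head_eq_of_cons_eq_runDecode {c d : Bool} {z r : List Bool}
    (h : d :: z = runDecode c r) : c = d := by
  match r with
  | [] => simp [runDecode] at h
  | false :: r => simp only [runDecode, List.cons.injEq] at h; exact h.1.symm
  | true :: r => simp only [runDecode, List.cons.injEq] at h; exact h.1.symm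

theorem exists_runDecode_eq (z : List Bool) (h0 : ∀ c, ¬ [c, c, c] <:+: z) :
    ∃ c r, z = runDecode c r := by
  match z with
  | [] => exact ⟨true, [], rfl⟩
  | [c] => exact ⟨c, [false], rfl⟩
  | [c, d] =>
    by_cases hcd : d = c
    · exact ⟨c, [true], by simp [runDecode, hcd]⟩
    · exact ⟨c, [false, false], by cases c <;> cases d <;> simp_all [runDecode]⟩
  | c :: d :: e :: z =>
    by_cases hcd : d = c
    · subst hcd
      obtain ⟨c', r, hr⟩ := exists_runDecode_eq (e :: z) fun c hc =>
        h0 c (hc.trans (List.suffix_append [d, d] _).isInfix)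
      have hed : e = !d := by
        have : e ≠ d := by rintro rfl; exact h0 e (List.prefix_append [e, e, e] z).isInfix
        cases e <;> cases d <;> simp_all
      exact ⟨d, true :: r, by rw [runDecode, hr, head_eq_of_cons_eq_runDecode hr, hed]⟩
    · obtain ⟨c', r, hr⟩ := exists_runDecode_eq (d :: e :: z) fun e he =>
        h0 e (he.trans (List.suffix_append [c] _).isInfix)
      have hd : d = !c := by cases d <;> cases c <;> simp_all
      exact ⟨c, false :: r, by rw [runDecode, hr, head_eq_of_cons_eq_runDecode hr, hd]⟩
termination_by z.length

/-! ### Parsing a word into blocks -/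

/-- After a factor `true false false` only `false` occurs in `m`, and after a factor
`true false true true true` only `true` occurs. -/
structure Tame (m : List Bool) : Prop where
  false_tail : ∀ l, [true, false, false] ++ l <:+ m → ∀ c ∈ l, c = false
  true_tail : ∀ l, [true, false, true, true, true] ++ l <:+ m → ∀ c ∈ l, c = true

theorem Tame.of_suffix {m m' : List Bool} (h : Tame m) (hm : m' <:+ m) : Tame m' :=
  ⟨fun l hl => h.false_tail l (hl.trans hm), fun l hl => h.true_tail l (hl.trans hm)⟩

/-- The possible tails of length at most `n` of a desubstituted word. -/
def powerTails (n : ℕ) : Finset (List Bool) :=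
  (Finset.range (n + 1)).image (fun k => List.replicate k false) ∪
    (Finset.range (n + 1)).image (fun k => false :: List.replicate k true)

/-- The possible heads of length at most `n` of a desubstituted word. -/
def powerHeads (n : ℕ) : Finset (List Bool) :=
  (Finset.range 3 ×ˢ Finset.range (n + 1)).image
      (fun p => List.replicate p.1 false ++ List.replicate p.2 true) ∪
    (Finset.range 3 ×ˢ Finset.range (n + 1)).image
      (fun p => List.replicate p.2 false ++ List.replicate p.1 true)

theorem replicate_false_mem_powerTails {k n : ℕ} (h : k ≤ n) :
    List.replicate k false ∈ powerTails n :=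
  Finset.mem_union_left _ (Finset.mem_image_of_mem _ (Finset.mem_range.2 (by omega)))

theorem cons_replicate_true_mem_powerTails {k n : ℕ} (h : k ≤ n) :
    false :: List.replicate k true ∈ powerTails n :=
  Finset.mem_union_right _ (Finset.mem_image.2 ⟨k, Finset.mem_range.2 (by omega), rfl⟩)

theorem mem_powerHeads {a b n : ℕ} (ha : a ≤ n) (hb : b ≤ n) (hab : a ≤ 2 ∨ b ≤ 2) :
    List.replicate a false ++ List.replicate b true ∈ powerHeads n := by
  rcases hab with h | h
  · exact Finset.mem_union_left _ (Finset.mem_image.2 ⟨(a, b), by simp; omega, rfl⟩)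
  · exact Finset.mem_union_right _ (Finset.mem_image.2 ⟨(b, a), by simp; omega, rfl⟩)

theorem card_powerTails_le (n : ℕ) : (powerTails n).card ≤ 2 * (n + 1) := by
  refine (Finset.card_union_le _ _).trans ?_
  have h1 := Finset.card_image_le (s := Finset.range (n + 1)) (f := fun k => List.replicate k false)
  have h2 := Finset.card_image_le (s := Finset.range (n + 1))
    (f := fun k => false :: List.replicate k true)
  simp only [Finset.card_range] at h1 h2
  omega

theorem card_powerHeads_le (n : ℕ) : (powerHeads n).card ≤ 6 * (n + 1) := by
  refine (Finset.card_union_le _ _).trans ?_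
  have h1 := Finset.card_image_le (s := Finset.range 3 ×ˢ Finset.range (n + 1))
    (f := fun p => List.replicate p.1 false ++ List.replicate p.2 true)
  have h2 := Finset.card_image_le (s := Finset.range 3 ×ˢ Finset.range (n + 1))
    (f := fun p => List.replicate p.2 false ++ List.replicate p.1 true)
  simp only [Finset.card_product, Finset.card_range] at h1 h2
  omega

/-- Blocks 01 and 011 are read off greedily. Parsing can only fail at 00 or 0111; the 1 just before
completes 100 or 10111, after which tameness makes the rest constant. -/
theorem Tame.exists_eq_blockSubst_append (r : List Bool) (h : Tame (true :: r))
    (hr : r = [] ∨ ∃ r', r = false :: r') :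
    ∃ w p, r = blockSubst w ++ p ∧ p ∈ powerTails r.length := by
  match r with
  | [] => exact ⟨[], [], rfl, replicate_false_mem_powerTails (k := 0) le_rfl⟩
  | true :: r => simp at hr
  | [false] => exact ⟨[], [false], rfl, replicate_false_mem_powerTails (k := 1) (by simp)⟩
  | false :: false :: r =>
    have hl := List.eq_replicate_of_mem (h.false_tail r List.suffix_rfl)
    refine ⟨[], List.replicate (r.length + 2) false, ?_, replicate_false_mem_powerTails (by simp)⟩
    conv_lhs => rw [hl]
    rfl
  | [false, true] => exact ⟨[false], [], rfl, replicate_false_mem_powerTails (k := 0) (by simp)⟩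
  | [false, true, true] =>
    exact ⟨[true], [], rfl, replicate_false_mem_powerTails (k := 0) (by simp)⟩
  | false :: true :: false :: r =>
    obtain ⟨w, p, hw, hp⟩ := Tame.exists_eq_blockSubst_append (false :: r)
      (h.of_suffix (List.suffix_append [true, false] _)) (Or.inr ⟨_, rfl⟩)
    refine ⟨false :: w, p, by simp [hw, blockSubst], ?_⟩
    revert hp
    simp only [powerTails, Finset.mem_union, Finset.mem_image, Finset.mem_range, List.length_cons]
    rintro (⟨k, hk, rfl⟩ | ⟨k, hk, rfl⟩)
    · exact Or.inl ⟨k, by omega, rfl⟩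
    · exact Or.inr ⟨k, by omega, rfl⟩
  | false :: true :: true :: false :: r =>
    obtain ⟨w, p, hw, hp⟩ := Tame.exists_eq_blockSubst_append (false :: r)
      (h.of_suffix (List.suffix_append [true, false, true] _)) (Or.inr ⟨_, rfl⟩)
    refine ⟨true :: w, p, by simp [hw, blockSubst], ?_⟩
    revert hp
    simp only [powerTails, Finset.mem_union, Finset.mem_image, Finset.mem_range, List.length_cons]
    rintro (⟨k, hk, rfl⟩ | ⟨k, hk, rfl⟩)
    · exact Or.inl ⟨k, by omega, rfl⟩
    · exact Or.inr ⟨k, by omega, rfl⟩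
  | false :: true :: true :: true :: r =>
    have hl := List.eq_replicate_of_mem (h.true_tail r List.suffix_rfl)
    refine ⟨[], false :: List.replicate (r.length + 3) true, ?_,
      cons_replicate_true_mem_powerTails (by simp)⟩
    conv_lhs => rw [hl]
    rfl
termination_by r.length

theorem exists_eq_replicate_append (m : List Bool) :
    ∃ a b r, m = List.replicate a false ++ List.replicate b true ++ r ∧ (b = 0 → r = []) ∧
      (r = [] ∨ ∃ r', r = false :: r') := by
  induction m with
  | nil => exact ⟨0, 0, [], rfl, fun _ => rfl, Or.inl rfl⟩
  | cons c m ih =>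
    obtain ⟨a, b, r, rfl, h, hr⟩ := ih
    cases c
    · exact ⟨a + 1, b, r, rfl, h, hr⟩
    · cases a with
      | zero => exact ⟨0, b + 1, r, rfl, by simp, hr⟩
      | succ a => exact ⟨0, 1, _, rfl, by simp, Or.inr ⟨_, rfl⟩⟩

theorem exists_replicate_append_eq (n : ℕ) (a : Bool) (l : List Bool) (h : ¬ ∀ c ∈ l, c = a) :
    ∃ x y, List.replicate n a ++ l = x ++ List.replicate n a ++ (!a) :: y := by
  induction l with
  | nil => simp at h
  | cons c l ih =>
    by_cases hc : c = a
    · obtain ⟨x, y, hxy⟩ := ih fun h' => h (by simpa [hc] using h')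
      exact ⟨a :: x, y, by
        rw [hc, ← List.singleton_append, ← List.append_assoc, ← List.replicate_succ',
          List.replicate_succ, List.cons_append, hxy]; simp⟩
    · exact ⟨[], l, by cases c <;> cases a <;> simp_all⟩

/-! ### Decomposition of avoiding words -/

/-- The three avoidance properties which desubstitution permutes cyclically. -/
def AvoidsSomeCenter (w : List Bool) : Prop :=
  AvoidsCenterTrue w ∨ AvoidsCenterFalse w ∨ AvoidsCenterEmpty w

theorem AvoidsCenterTrue.of_infix {w w' : List Bool} (h : AvoidsCenterTrue w) (hw : w' <:+: w) :
    AvoidsCenterTrue w' :=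
  ⟨fun q hq hi => h.square q hq (hi.of_infix hw),
    fun q hq hi => h.long_border q hq (hi.of_infix hw),
    fun q hq hi => h.short_border q hq (hi.of_infix hw)⟩

theorem AvoidsCenterFalse.of_infix {w w' : List Bool} (h : AvoidsCenterFalse w) (hw : w' <:+: w) :
    AvoidsCenterFalse w' :=
  ⟨fun q hq hi => h.square q hq (hi.of_infix hw), fun q hq hi => h.mixed q hq (hi.of_infix hw)⟩

theorem AvoidsCenterEmpty.of_infix {w w' : List Bool} (h : AvoidsCenterEmpty w) (hw : w' <:+: w) :
    AvoidsCenterEmpty w' :=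
  ⟨fun q hq hi => h.long_border q hq (hi.of_infix hw),
    fun q hq hi => h.short_border q hq (hi.of_infix hw),
    fun hi => h.true_false_false (hi.of_infix hw)⟩

theorem AvoidsSomeCenter.of_infix {w w' : List Bool} (h : AvoidsSomeCenter w) (hw : w' <:+: w) :
    AvoidsSomeCenter w' :=
  h.imp (·.of_infix hw) (Or.imp (·.of_infix hw) (·.of_infix hw))

theorem AvoidsSomeCenter.desubst {w : List Bool} (h : AvoidsSomeCenter (blockSubst w)) :
    AvoidsSomeCenter w := by
  rcases h with h | h | h
  · exact Or.inr (Or.inl h.desubst)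
  · exact Or.inr (Or.inr h.desubst)
  · exact Or.inl h.desubst

theorem occursInside_of_eq {u m v p x y : List Bool} (hu : 2 ≤ u.length) (hv : 2 ≤ v.length)
    (h : m = x ++ p ++ y) : OccursInside p (u ++ m ++ v) :=
  ⟨u ++ x, y ++ v, by simp; omega, by simp; omega, by simp [h]⟩

/-- Only the shortest patterns matter: 001 and 10111 for centre 1, 00 and 11101 for centre 0, 100
and 111 for empty centre. -/
theorem AvoidsSomeCenter.tame {u m v : List Bool} (h : AvoidsSomeCenter (u ++ m ++ v))
    (hu : 2 ≤ u.length) (hv : 3 ≤ v.length) : Tame m := by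
  have hv2 : 2 ≤ v.length := by omega
  rcases h with h | h | h
  · constructor
    · rintro l ⟨x, rfl⟩
      by_contra hl
      obtain ⟨x', y, hxy⟩ := exists_replicate_append_eq 2 false l hl
      refine h.short_border [] (by simp) (occursInside_of_eq (x := x ++ true :: x') (y := y) hu hv2 ?_)
      simpa using hxy
    · rintro l ⟨x, rfl⟩
      exact absurd (occursInside_of_eq (x := x) (y := l) hu hv2 (by simp))
        (h.long_border [] (by simp))
  · constructor
    · rintro l ⟨x, rfl⟩
      exact absurd (occursInside_of_eq (x := x ++ [true]) (y := l) hu hv2 (by simp))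
        (h.square [] (by simp))
    · rintro l ⟨x, rfl⟩
      by_contra hl
      obtain ⟨x', y, hxy⟩ := exists_replicate_append_eq 3 true l hl
      obtain ⟨e, v, rfl⟩ : ∃ e v', v = e :: v' := by
        cases v with
        | nil => simp at hv
        | cons e v => exact ⟨e, v, rfl⟩
      have hv3 : 2 ≤ v.length := by simpa using hv
      -- A 0 after 111 yields 00 or 11101 according to the next letter d, which may already be the
      -- first letter of v; hence the third letter of margin.
      have key : ∀ d y', y ++ [e] = d :: y' → False := by
        intro d y' hd
        have he : u ++ (x ++ ([true, false, true, true, true] ++ l)) ++ e :: v =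
            u ++ (x ++ [true, false] ++ (x' ++ [true, true, true, false, d]) ++ y') ++ v := by
          have h1 : x' ++ [true, true, true, false] ++ (y ++ [e]) =
              x' ++ [true, true, true, false] ++ (d :: y') := by rw [hd]
          have h2 : [true, true, true] ++ l = x' ++ [true, true, true, false] ++ y := by
            simpa using hxy
          have h3 : [true, true, true] ++ l ++ [e] =
              x' ++ [true, true, true, false] ++ (d :: y') := by
            rw [h2, ← h1]; simp
          have h4 : u ++ (x ++ ([true, false, true, true, true] ++ l)) ++ e :: v =
            u ++ (x ++ [true, false]) ++ ([true, true, true] ++ l ++ [e]) ++ v := by simp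
          rw [h4, h3]; simp
        rw [he] at h
        cases d
        · exact absurd (occursInside_of_eq
            (x := x ++ [true, false] ++ x' ++ [true, true, true]) (y := y') hu hv3 (by simp))
            (h.square [] (by simp))
        · exact absurd (occursInside_of_eq
            (x := x ++ [true, false] ++ x') (y := y') hu hv3 (by simp))
            (h.mixed [true] (by simp))
      cases y with
      | nil => exact key e [] rfl
      | cons d y => exact key d (y ++ [e]) rfl
  · constructor
    · rintro l ⟨x, rfl⟩
      exact absurd (occursInside_of_eq (x := x) (y := l) hu hv2 (by simp)) h.true_false_false
    · rintro l ⟨x, rfl⟩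
      exact absurd (occursInside_of_eq (x := x ++ [true, false]) (y := l) hu hv2 (by simp))
        (h.long_border [] (by simp))

/-- The word 000111 contains 001, 00 and 111, one forbidden factor for each family. -/
theorem AvoidsSomeCenter.exponent_le_two {u v r : List Bool} {a b : ℕ}
    (h : AvoidsSomeCenter (u ++ (List.replicate a false ++ List.replicate b true ++ r) ++ v))
    (hu : 2 ≤ u.length) (hv : 2 ≤ v.length) : a ≤ 2 ∨ b ≤ 2 := by
  by_contra! hab
  obtain ⟨a, rfl⟩ := Nat.exists_eq_add_of_le' hab.1
  obtain ⟨b, rfl⟩ := Nat.exists_eq_add_of_le' hab.2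
  have e : List.replicate (a + 2 + 1) false ++ List.replicate (b + 2 + 1) true ++ r =
      List.replicate a false ++ [false, false, false, true, true, true] ++
        (List.replicate b true ++ r) := by
    have e₁ : List.replicate (a + 2 + 1) false =
        List.replicate a false ++ [false, false, false] := List.replicate_add a 3 false
    have e₂ : List.replicate (b + 2 + 1) true = [true, true, true] ++ List.replicate b true := rfl
    rw [e₁, e₂]
    simp
  rcases h with h | h | h
  · exact absurd (occursInside_of_eq (x := List.replicate a false ++ [false])
      (y := [true, true] ++ (List.replicate b true ++ r)) hu hv (by rw [e]; simp))
      (h.short_border [] (by simp))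
  · exact absurd (occursInside_of_eq (x := List.replicate a false ++ [false])
      (y := [true, true, true] ++ (List.replicate b true ++ r)) hu hv (by rw [e]; simp))
      (h.square [] (by simp))
  · exact absurd (occursInside_of_eq (x := List.replicate a false ++ [false, false, false])
      (y := List.replicate b true ++ r) hu hv (by rw [e]; simp))
      (h.long_border [] (by simp))

theorem powerTails_mono {m n : ℕ} (h : m ≤ n) : powerTails m ⊆ powerTails n := by
  have : Finset.range (m + 1) ⊆ Finset.range (n + 1) := Finset.range_mono (by omega)
  exact Finset.union_subset_union (Finset.image_subset_image this) (Finset.image_subset_image this)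

theorem AvoidsSomeCenter.exists_eq_append_blockSubst {w : List Bool} (h : AvoidsSomeCenter w) :
    ∃ u p w' q v, w = u ++ p ++ blockSubst w' ++ q ++ v ∧ u.length ≤ 4 ∧ v.length ≤ 4 ∧
      p ∈ powerHeads w.length ∧ q ∈ powerTails w.length ∧ AvoidsSomeCenter w' := by
  have hnil : AvoidsSomeCenter [] := by
    refine Or.inr (Or.inl ⟨?_, ?_⟩) <;>
    · rintro y - ⟨u, v, hu, hv, he⟩
      simp at he
  have hP : ([] : List Bool) ∈ powerHeads w.length :=
    mem_powerHeads (a := 0) (b := 0) (by simp) (by simp) (by simp)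
  have hT : ([] : List Bool) ∈ powerTails w.length :=
    replicate_false_mem_powerTails (k := 0) (by simp)
  by_cases hw : w.length ≤ 4
  · exact ⟨w, [], [], [], [], by simp [blockSubst], hw, by simp, hP, hT, hnil⟩
  obtain ⟨u, m, v, rfl, hu, hv⟩ : ∃ u m v, w = u ++ m ++ v ∧ u.length = 2 ∧ v.length = 3 := by
    refine ⟨w.take 2, (w.drop 2).take (w.length - 5), w.drop (w.length - 3), ?_, ?_, ?_⟩
    · have h1 : w.drop (w.length - 3) = (w.drop 2).drop (w.length - 5) := by
        rw [List.drop_drop]; congr 1; omega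
      rw [h1, List.append_assoc, List.take_append_drop, List.take_append_drop]
    · simp; omega
    · simp; omega
  have ht := h.tame hu.ge hv.ge
  obtain ⟨a, b, r, rfl, hb, hr⟩ := exists_eq_replicate_append m
  have hab := h.exponent_le_two hu.ge (by omega)
  have hp : List.replicate a false ++ List.replicate b true ∈
      powerHeads (u ++ (List.replicate a false ++ List.replicate b true ++ r) ++ v).length :=
    mem_powerHeads (by simp; omega) (by simp; omega) hab
  rcases Nat.eq_zero_or_pos b with h0 | h0
  · obtain rfl := hb h0
    exact ⟨u, _, [], [], v, by simp [blockSubst], by omega, by omega, hp, hT, hnil⟩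
  · obtain ⟨b, rfl⟩ := Nat.exists_eq_add_of_le' h0
    -- The last 1 of the head is the letter that the parsing needs in front of r.
    obtain ⟨w', q, rfl, hq⟩ := Tame.exists_eq_blockSubst_append r
      (ht.of_suffix ⟨List.replicate a false ++ List.replicate b true, by
        simp [List.replicate_succ']⟩) hr
    refine ⟨u, _, w', q, v, by simp, by omega, by omega, hp, powerTails_mono (by simp; omega) hq, ?_⟩
    exact (h.of_infix ⟨u ++ (List.replicate a false ++ List.replicate (b + 1) true), q ++ v,
      by simp⟩).desubst

/-! ### Counting and the recurrence -/

/-- The words of length at most `n` with one of the three avoidance properties. -/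
def avoidsSomeCenterWords (n : ℕ) : Set (List Bool) :=
  {w | w.length ≤ n ∧ AvoidsSomeCenter w}

theorem finite_avoidsSomeCenterWords (n : ℕ) : (avoidsSomeCenterWords n).Finite :=
  (List.finite_length_le Bool n).subset fun _ hw => hw.1

theorem powerHeads_mono {m n : ℕ} (h : m ≤ n) : powerHeads m ⊆ powerHeads n := by
  have : Finset.range (m + 1) ⊆ Finset.range (n + 1) := Finset.range_mono (by omega)
  exact Finset.union_subset_union
    (Finset.image_subset_image (Finset.product_subset_product_right this))
    (Finset.image_subset_image (Finset.product_subset_product_right this))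

theorem exists_ncard_avoidsSomeCenterWords_le :
    ∃ C : ℕ, ∀ n, (avoidsSomeCenterWords n).ncard ≤
      C * (n + 1) ^ 2 * (avoidsSomeCenterWords (n / 2)).ncard := by
  set T : Set (List Bool) := {l | l.length ≤ 4} with hT
  have hTf : T.Finite := List.finite_length_le Bool 4
  refine ⟨T.ncard * (6 * 2) * T.ncard, fun n => ?_⟩
  set A := avoidsSomeCenterWords (n / 2) with hA
  have hAf : A.Finite := finite_avoidsSomeCenterWords _
  set P : Set (List Bool) := ↑(powerHeads n) with hP
  set Q : Set (List Bool) := ↑(powerTails n) with hQ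
  set S : Set (List Bool × List Bool × List Bool × List Bool × List Bool) :=
    T ×ˢ P ×ˢ A ×ˢ Q ×ˢ T with hS
  have hSf : S.Finite := hTf.prod ((Finset.finite_toSet _).prod
    (hAf.prod ((Finset.finite_toSet _).prod hTf)))
  have hsub : avoidsSomeCenterWords n ⊆
      (fun x => x.1 ++ x.2.1 ++ blockSubst x.2.2.1 ++ x.2.2.2.1 ++ x.2.2.2.2) '' S := by
    rintro w ⟨hwn, hw⟩
    obtain ⟨u, p, w', q, v, rfl, hu, hv, hp, hq, hw'⟩ := hw.exists_eq_append_blockSubst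
    refine ⟨(u, p, w', q, v), ⟨hu, powerHeads_mono hwn hp, ⟨?_, hw'⟩, powerTails_mono hwn hq, hv⟩,
      rfl⟩
    have := two_mul_length_le_length_blockSubst w'
    simp only [List.length_append] at hwn
    change w'.length ≤ n / 2
    omega
  have hPc : P.ncard ≤ 6 * (n + 1) := by
    rw [hP, Set.ncard_coe_finset]; exact card_powerHeads_le n
  have hQc : Q.ncard ≤ 2 * (n + 1) := by
    rw [hQ, Set.ncard_coe_finset]; exact card_powerTails_le n
  calc (avoidsSomeCenterWords n).ncard
      ≤ S.ncard := (Set.ncard_le_ncard hsub (hSf.image _)).trans (Set.ncard_image_le hSf)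
    _ = T.ncard * (P.ncard * (A.ncard * (Q.ncard * T.ncard))) := by
        simp only [hS, Set.ncard_prod]
    _ ≤ T.ncard * ((6 * (n + 1)) * (A.ncard * ((2 * (n + 1)) * T.ncard))) := by gcongr
    _ = _ := by ring

theorem numAvoidingWords_le (n : ℕ) :
    numAvoidingWords n ≤ 2 * (avoidsSomeCenterWords n).ncard := by
  have hf := finite_avoidsSomeCenterWords n
  have hsub : avoidingWords n ⊆ (fun x : Bool × List Bool => runDecode x.1 x.2) ''
      ((Set.univ : Set Bool) ×ˢ avoidsSomeCenterWords n) := by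
    rintro z ⟨hn, hz⟩
    obtain ⟨c, r, rfl⟩ := exists_runDecode_eq z fun c => hz [c] (by simp)
    exact ⟨(c, r), ⟨trivial, hn ▸ length_le_length_runDecode c r, Or.inl hz.avoidsCenterTrue⟩, rfl⟩
  have hSf := (Set.finite_univ (α := Bool)).prod hf
  calc numAvoidingWords n
      ≤ ((Set.univ : Set Bool) ×ˢ avoidsSomeCenterWords n).ncard :=
        (Set.ncard_le_ncard hsub (hSf.image _)).trans (Set.ncard_image_le hSf)
    _ = 2 * (avoidsSomeCenterWords n).ncard := by
        rw [Set.ncard_prod, Set.ncard_univ]; simp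

/-- With L = lg n, the exponent L(L+c) drops by 2L + c - 1 when L drops by 1; this must pay for the
factor D(2n)² = 4Dn². -/
theorem exists_le_rpow_of_le_half {F : ℕ → ℝ} {C : ℝ} (hC : 0 ≤ C)
    (h : ∀ n, F n ≤ C * ((n : ℝ) + 1) ^ 2 * F (n / 2)) :
    ∃ K c : ℝ, ∀ n : ℕ, 1 ≤ n → F n ≤ K * (n : ℝ) ^ (Real.logb 2 n + c) := by
  set D : ℝ := max C 1 with hD
  have hD1 : 1 ≤ D := le_max_right _ _
  -- Chosen so that 2^(c-1) = 4D.
  set c : ℝ := Real.logb 2 (8 * D) with hc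
  have hc0 : 0 ≤ c := Real.logb_nonneg (by norm_num) (by linarith)
  have h2c : (2 : ℝ) ^ c = 8 * D := Real.rpow_logb (by norm_num) (by norm_num) (by linarith)
  set K : ℝ := |F 1| with hK
  have hK0 : 0 ≤ K := abs_nonneg _
  refine ⟨K, c, fun n => ?_⟩
  induction n using Nat.strong_induction_on with
  | _ n ih =>
    intro hn
    rcases eq_or_lt_of_le hn with rfl | hn2
    · simpa using le_abs_self (F 1)
    have hm : 1 ≤ n / 2 := by omega
    have hmn : ((n / 2 : ℕ) : ℝ) ≤ n / 2 := by exact_mod_cast Nat.cast_div_le (α := ℝ)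
    have hm1 : (1 : ℝ) ≤ ((n / 2 : ℕ) : ℝ) := by exact_mod_cast hm
    have hn1 : (1 : ℝ) ≤ n := by exact_mod_cast hn
    have hn0 : (0 : ℝ) < n := by linarith
    set m : ℝ := ((n / 2 : ℕ) : ℝ) with hmdef
    set L : ℝ := Real.logb 2 n with hL
    set M : ℝ := Real.logb 2 m with hM
    have hM0 : 0 ≤ M := Real.logb_nonneg (by norm_num) hm1
    have hML : M ≤ L - 1 := by
      have h1 : L - 1 = Real.logb 2 (n / 2) := by
        rw [Real.logb_div hn0.ne' (by norm_num), Real.logb_self_eq_one (by norm_num)]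
      rw [h1]
      exact Real.logb_le_logb_of_le (by norm_num) (by linarith) hmn
    have hmL : m = (2 : ℝ) ^ M := (Real.rpow_logb (by norm_num) (by norm_num) (by linarith)).symm
    have hnL : (n : ℝ) = (2 : ℝ) ^ L := (Real.rpow_logb (by norm_num) (by norm_num) hn0).symm
    have hpow : m ^ (M + c) * (4 * D * (n : ℝ) ^ 2) ≤ (n : ℝ) ^ (L + c) := by
      have h1 : m ^ (M + c) ≤ (2 : ℝ) ^ ((L - 1) * (L - 1 + c)) := by
        rw [hmL, ← Real.rpow_mul (by norm_num)]
        exact Real.rpow_le_rpow_of_exponent_le (by norm_num) (by gcongr; linarith)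
      have h2 : 4 * D * (n : ℝ) ^ 2 = (2 : ℝ) ^ (c - 1 + 2 * L) := by
        rw [Real.rpow_add (by norm_num), Real.rpow_sub (by norm_num), h2c, mul_comm 2 L,
          Real.rpow_mul (by norm_num), ← hnL]
        norm_num
        left
        ring
      have h3 : (n : ℝ) ^ (L + c) = (2 : ℝ) ^ ((L - 1) * (L - 1 + c) + (c - 1 + 2 * L)) := by
        conv_lhs => rw [hnL]
        rw [← Real.rpow_mul (by norm_num)]
        ring_nf
      rw [h3, Real.rpow_add (x := 2) (by norm_num), h2]
      gcongr
    have hF := ih (n / 2) (by omega) hm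
    calc F n ≤ C * ((n : ℝ) + 1) ^ 2 * F (n / 2) := h n
      _ ≤ C * ((n : ℝ) + 1) ^ 2 * (K * m ^ (M + c)) := by gcongr
      _ ≤ D * ((n : ℝ) + n) ^ 2 * (K * m ^ (M + c)) := by
        gcongr
        exact le_max_left _ _
      _ = K * (m ^ (M + c) * (4 * D * (n : ℝ) ^ 2)) := by ring
      _ ≤ K * (n : ℝ) ^ (L + c) := by gcongr

theorem mainTheorem1 :
    ∃ c : ℝ, (fun n : ℕ => (numAvoidingWords n : ℝ)) =O[Filter.atTop]
      fun n : ℕ => (n : ℝ) ^ (Real.logb 2 (n : ℝ) + c) := by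
  obtain ⟨C, hC⟩ := exists_ncard_avoidsSomeCenterWords_le
  obtain ⟨K, c, hK⟩ := exists_le_rpow_of_le_half (C := C)
    (F := fun n => ((avoidsSomeCenterWords n).ncard : ℝ)) C.cast_nonneg
    fun n => by exact_mod_cast hC n
  refine ⟨c, Asymptotics.IsBigO.of_bound (2 * K) ?_⟩
  filter_upwards [Filter.eventually_ge_atTop 1] with n hn
  have h1 : (numAvoidingWords n : ℝ) ≤ 2 * ((avoidsSomeCenterWords n).ncard : ℝ) := by
    exact_mod_cast numAvoidingWords_le n
  have h2 := hK n hn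
  rw [Real.norm_of_nonneg (Nat.cast_nonneg _), Real.norm_of_nonneg (by positivity)]
  linarith
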